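/- Conventions. Let $X$ be a set. For a cover $\mathcal U$ of $X$ and $A\subset X$ put $St^0(A,\mathcal U)=A$ and $St^{m+1}(A,\mathcal U)=\bigcup\{U\in\mathcal U: U\cap St^{m}(A,\mathcal U)\neq\emptyset\}$. A cover $\mathcal U$ of a metric space $(X,d)$ is *uniform* if for some $\varepsilon>0$ every open ball of radius $\varepsilon$ is contained in a member of $\mathcal U$. A (proper) filter $\mathcal F$ on $X$ is *Bourbaki–Cauchy* if for every uniform cover $\mathcal U$ there are $m\in\mathbb N$, $U\in\mathcal U$ and $F\in\mathcal F$ with $F\subset St^m(U,\mathcal U)$; and $(X,d)$ is *Bourbaki-complete* if every Bourbaki–Cauchy filter has a cluster point. A *uniform partition* of $(X,d)$ is a partition of $X$ that is a uniform cover, and $\wp(X,d)$ is the supremum of the cardinalities of all uniform partitions of $(X,d)$. Given cardinals $\kappa_n$ $(n\geq 1)$, regarded as sets with the uniformly discrete metric (distinct points are at distance $1$), $\prod_{n}\kappa_n$ carries the first-difference metric $\rho$, where $\rho(x,x)=0$ and $\rho(x,y)=1/n$ if $n$ is the least index with $x_n\neq y_n$; $\mathbb R^{\omega_0}$ carries the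 metric $t(x,y)=\sum_{n\ge 1}2^{-n}\min\{|x_n-y_n|,1\}$; and $\big(\prod_n\kappa_n\big)\times\mathbb R^{\omega_0}$ carries the metric $\rho+t$. Theorem. Let $(X,d)$ be a Bourbaki-complete metric space. Then there exist cardinals $\kappa_n$ $(n\geq 1)$ and a map $$\varphi:(X,d)\to\Big(\big(\prod_{n\ge 1}\kappa_n\big)\times\mathbb R^{\omega_0},\ \rho+t\Big)$$ that is a topological embedding (a homeomorphism onto its image), is uniformly continuous, and has closed image $\varphi(X)$. Moreover, $\wp(X,d)\le\sup\big\{\prod_{j=1}^n\kappa_j : n\geq 1\big\}$. -/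

import Mathlib

universe u

namespace BourbakiEmbedding

/-! ### Covering uniformities, stars, Bourbaki-completeness -/

/-- `𝒰` is a uniform cover of `X`: it belongs to the covering uniformity of `X`, that is, it is
refined by the cover by `V`-balls for some entourage `V` (for a metric space: by the cover
by all open balls of some radius `ε > 0`). -/
def IsUniformCover {X : Type u} [UniformSpace X] (𝒰 : Set (Set X)) : Prop :=
  ∃ V ∈ uniformity X, ∀ x : X, ∃ U ∈ 𝒰, UniformSpace.ball x V ⊆ U

/-- The star `St(A, 𝒞) = ⋃ {C ∈ 𝒞 : C ∩ A ≠ ∅}`. -/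
def starOf {X : Type u} (𝒞 : Set (Set X)) (A : Set X) : Set X :=
  ⋃₀ {C | C ∈ 𝒞 ∧ (C ∩ A).Nonempty}

/-- The iterated star: `St⁰(A, 𝒞) = A` and `Stᵐ⁺¹(A, 𝒞) = St(Stᵐ(A, 𝒞), 𝒞)`. -/
def iterStar {X : Type u} (𝒞 : Set (Set X)) : ℕ → Set X → Set X
  | 0, A => A
  | m + 1, A => starOf 𝒞 (iterStar 𝒞 m A)

/-- A filter is Bourbaki-Cauchy if for every uniform cover `𝒰` some member of the filter lies in
`Stᵐ(U, 𝒰)` for some `m` and some `U ∈ 𝒰`. -/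
def IsBourbakiCauchy {X : Type u} [UniformSpace X] (F : Filter X) : Prop :=
  ∀ 𝒰 : Set (Set X), IsUniformCover 𝒰 →
    ∃ m : ℕ, ∃ U ∈ 𝒰, ∃ S ∈ F, S ⊆ iterStar 𝒰 m U

/-- A uniform space is Bourbaki-complete if every (proper) Bourbaki-Cauchy filter has a
cluster point. -/
def IsBourbakiComplete (X : Type u) [UniformSpace X] : Prop :=
  ∀ F : Filter X, F.NeBot → IsBourbakiCauchy F → ∃ x : X, ClusterPt x F

/-! ### Uniform partitions and the cardinal `℘(X)` -/

/-- A uniform partition: a partition of `X` (into nonempty sets) that is a uniform cover. -/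
def IsUniformPartition {X : Type u} [UniformSpace X] (P : Set (Set X)) : Prop :=
  Setoid.IsPartition P ∧ IsUniformCover P

/-- `℘(X)`, the supremum of the cardinalities of the uniform partitions of `X`. -/
noncomputable def wp (X : Type u) [UniformSpace X] : Cardinal.{u} :=
  ⨆ P : {P : Set (Set X) // IsUniformPartition P}, Cardinal.mk P.1

/-! ### The space `(∏ₙ κₙ) × ℝ^ω` with the metric `ρ + t` -/

/-- The first-difference metric on a countable product of discrete sets. The coordinates are
indexed from `0`, so the value at a first difference in coordinate `n` is `1 / (n + 1)`. -/
noncomputable def rho {E : ℕ → Type u} (x y : ∀ n, E n) : ℝ :=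
  open Classical in if x = y then 0 else 1 / ((PiNat.firstDiff x y : ℝ) + 1)

/-- The product metric on `ℝ^ω`. The coordinates are indexed from `0`, so coordinate `n` has
weight `2 ^ (-(n + 1))`. -/
noncomputable def tDist (x y : ℕ → ℝ) : ℝ :=
  ∑' n : ℕ, min |x n - y n| 1 / 2 ^ (n + 1)

theorem rho_self {E : ℕ → Type u} (x : ∀ n, E n) : rho x x = 0 := by simp [rho]

theorem rho_comm {E : ℕ → Type u} (x y : ∀ n, E n) : rho x y = rho y x := by
  unfold rho
  rw [PiNat.firstDiff_comm x y]
  split_ifs with h1 h2 h2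
  · rfl
  · exact absurd h1.symm h2
  · exact absurd h2.symm h1
  · rfl

theorem rho_nonneg {E : ℕ → Type u} (x y : ∀ n, E n) : 0 ≤ rho x y := by
  unfold rho
  split_ifs
  · exact le_rfl
  · positivity

theorem eq_of_rho {E : ℕ → Type u} (x y : ∀ n, E n) (h : rho x y = 0) : x = y := by
  by_contra hne
  rw [rho, if_neg hne] at h
  have : (0 : ℝ) < 1 / ((PiNat.firstDiff x y : ℝ) + 1) := by positivity
  exact this.ne' h

theorem rho_triangle {E : ℕ → Type u} (x y z : ∀ n, E n) :
    rho x z ≤ rho x y + rho y z := by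
  by_cases hxz : x = z
  · subst hxz
    rw [rho_self]
    exact add_nonneg (rho_nonneg _ _) (rho_nonneg _ _)
  by_cases hxy : x = y
  · subst hxy
    rw [rho_self, zero_add]
  by_cases hyz : y = z
  · subst hyz
    rw [rho_self, add_zero]
  have hmin := PiNat.min_firstDiff_le x y z hxz
  have hle : rho x z ≤ max (rho x y) (rho y z) := by
    simp only [rho, if_neg hxz, if_neg hxy, if_neg hyz]
    rcases min_le_iff.1 hmin with h | h
    · refine le_max_of_le_left (one_div_le_one_div_of_le (by positivity) ?_)
      exact_mod_cast Nat.succ_le_succ h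
    · refine le_max_of_le_right (one_div_le_one_div_of_le (by positivity) ?_)
      exact_mod_cast Nat.succ_le_succ h
  exact hle.trans (max_le_add_of_nonneg (rho_nonneg _ _) (rho_nonneg _ _))

theorem tDist_term_nonneg (x y : ℕ → ℝ) (n : ℕ) :
    0 ≤ min |x n - y n| 1 / (2 : ℝ) ^ (n + 1) := by
  positivity

theorem tDist_summable (x y : ℕ → ℝ) :
    Summable fun n : ℕ => min |x n - y n| 1 / (2 : ℝ) ^ (n + 1) := by
  refine Summable.of_nonneg_of_le (tDist_term_nonneg x y) (fun n => ?_)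
    ((summable_nat_add_iff 1).2 summable_geometric_two)
  rw [div_pow, one_pow]
  gcongr
  exact min_le_right _ _

theorem tDist_self (x : ℕ → ℝ) : tDist x x = 0 := by simp [tDist]

theorem tDist_comm (x y : ℕ → ℝ) : tDist x y = tDist y x := by
  simp only [tDist, abs_sub_comm]

theorem tDist_nonneg (x y : ℕ → ℝ) : 0 ≤ tDist x y :=
  tsum_nonneg (tDist_term_nonneg x y)

theorem tDist_triangle (x y z : ℕ → ℝ) : tDist x z ≤ tDist x y + tDist y z := by
  unfold tDist
  rw [← (tDist_summable x y).tsum_add (tDist_summable y z)]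
  refine (tDist_summable x z).tsum_le_tsum (fun n => ?_)
    ((tDist_summable x y).add (tDist_summable y z))
  rw [← add_div]
  gcongr
  have h := abs_sub_le (x n) (y n) (z n)
  have h1 := abs_nonneg (x n - y n)
  have h2 := abs_nonneg (y n - z n)
  rcases min_cases |x n - z n| 1 with h3 | h3 <;> rcases min_cases |x n - y n| 1 with h4 | h4 <;>
    rcases min_cases |y n - z n| 1 with h5 | h5 <;> linarith

theorem eq_of_tDist (x y : ℕ → ℝ) (h : tDist x y = 0) : x = y := by
  funext n
  have h0 := (tDist_summable x y).le_tsum n fun m _ => tDist_term_nonneg x y m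
  have h1 : min |x n - y n| 1 / (2 : ℝ) ^ (n + 1) = 0 :=
    le_antisymm (h0.trans h.le) (tDist_term_nonneg x y n)
  have h2 : min |x n - y n| 1 = 0 := by
    rcases div_eq_zero_iff.1 h1 with h2 | h2
    · exact h2
    · exact absurd h2 (by positivity)
  rcases min_cases |x n - y n| 1 with h3 | h3
  · exact sub_eq_zero.1 (abs_eq_zero.1 (h3.1.symm.trans h2))
  · linarith [h3.1]

/-- The set `(∏ₙ κₙ) × ℝ^ω`, where the cardinal `κₙ` is the set of the ordinals below it. It is
a type synonym: its metric is `ρ + t`, not the supremum metric of a product. -/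
def UniversalSpace (κ : ℕ → Cardinal.{u}) : Type u :=
  (∀ n : ℕ, (κ n).ord.ToType) × (ℕ → ℝ)

/-- The metric `ρ + t` on `(∏ₙ κₙ) × ℝ^ω`. -/
noncomputable instance instMetricSpaceUniversalSpace (κ : ℕ → Cardinal.{u}) :
    MetricSpace (UniversalSpace κ) where
  dist a b := rho a.1 b.1 + tDist a.2 b.2
  dist_self a := by rw [rho_self, tDist_self, add_zero]
  dist_comm a b := by rw [rho_comm, tDist_comm]
  dist_triangle a b c := by
    have h1 := rho_triangle a.1 b.1 c.1
    have h2 := tDist_triangle a.2 b.2 c.2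
    linarith
  eq_of_dist_eq_zero := by
    intro a b h
    have h1 := rho_nonneg a.1 b.1
    have h2 := tDist_nonneg a.2 b.2
    exact Prod.ext (eq_of_rho _ _ (by linarith)) (eq_of_tDist _ _ (by linarith))

end BourbakiEmbedding

namespace BourbakiEmbedding

open Filter Topology

/-! ### Chain components and chain length -/

section Chains

variable {X : Type u} [PseudoMetricSpace X]

/-! At each scale `ε = 1 / (n + 1)` a point is described by its chain component (a discrete
coordinate) and its chain length to a base point of that component (a real coordinate). Both are
uniformly continuous: points closer than `ε` share the component and base point, and their lengths
differ by at most their distance.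

If the images of a filter converge, then at every scale the component is eventually constant and the
length eventually bounded. A chain of bounded length can be regrouped into boundedly many stars
(`HasChain.exists_mem_iterStar`), so the filter is Bourbaki-Cauchy and has a cluster point. Hence
the map is closed.

Injectivity needs further real coordinates. Bourbaki-completeness makes the set of points with
prescribed components and length bounds coverable by finitely many `δ`-balls, already when finitely
many scales are prescribed (`exists_finite_cover_boundedPart`). Distances to the centres then
separate points, and finitely many integer bounds leave only countably many coordinates.

Finally, blocks of a uniform partition are unions of chain components at some scale, which bounds
`wp`. -/

/-- Two points are equivalent when they are joined by a finite chain of steps shorter than `ε`. -/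
def chainSetoid (X : Type u) [PseudoMetricSpace X] (ε : ℝ) : Setoid X where
  r := Relation.ReflTransGen fun x y => dist x y < ε
  iseqv :=
    ⟨fun _ => .refl, fun h => by
      have : Std.Symm fun x y : X => dist x y < ε := ⟨fun x y h => by rwa [dist_comm]⟩
      exact Relation.ReflTransGen.stdSymm.symm _ _ h, fun h h' => h.trans h'⟩

/-- The type of chain components of `X` for steps shorter than `ε`. -/
abbrev ChainComponent (X : Type u) [PseudoMetricSpace X] (ε : ℝ) : Type u :=
  Quotient (chainSetoid X ε)

/-- The chain component of a point. -/
def chainComponent (ε : ℝ) (x : X) : ChainComponent X ε :=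
  Quotient.mk (chainSetoid X ε) x

theorem chainComponent_eq_iff {ε : ℝ} {x y : X} :
    chainComponent ε x = chainComponent ε y ↔
      Relation.ReflTransGen (fun x y => dist x y < ε) x y :=
  Quotient.eq

theorem chainComponent_eq_of_dist_lt {ε : ℝ} {x y : X} (h : dist x y < ε) :
    chainComponent ε x = chainComponent ε y :=
  chainComponent_eq_iff.2 (.single h)

/-- A base point of a chain component. -/
noncomputable def basePoint {ε : ℝ} (c : ChainComponent X ε) : X := Quotient.out c

theorem chainComponent_basePoint {ε : ℝ} (c : ChainComponent X ε) :
    chainComponent ε (basePoint c) = c :=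
  Quotient.out_eq c

/-- `HasChain ε b s x`: some chain of steps shorter than `ε` from `b` to `x` has total
length `s`. -/
inductive HasChain (ε : ℝ) (b : X) : ℝ → X → Prop
  | base : HasChain ε b 0 b
  | step {s : ℝ} {x y : X} (h : HasChain ε b s x) (hxy : dist x y < ε) :
      HasChain ε b (s + dist x y) y

theorem HasChain.nonneg {ε s : ℝ} {b x : X} (h : HasChain ε b s x) : 0 ≤ s := by
  induction h with
  | base => exact le_rfl
  | step _ _ ih => exact add_nonneg ih dist_nonneg

theorem exists_hasChain {ε : ℝ} {b x : X} (h : chainComponent ε b = chainComponent ε x) :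
    ∃ s, HasChain ε b s x := by
  replace h := chainComponent_eq_iff.1 h
  induction h with
  | refl => exact ⟨0, .base⟩
  | tail _ h ih =>
    obtain ⟨s, hs⟩ := ih
    exact ⟨_, hs.step h⟩

/-- The infimum of the lengths of the chains of steps shorter than `ε` that join `x` to the base
point of its chain component. -/
noncomputable def chainLength (ε : ℝ) (x : X) : ℝ :=
  sInf {s | HasChain ε (basePoint (chainComponent ε x)) s x}

theorem chainLength_le {ε s : ℝ} {x : X}
    (h : HasChain ε (basePoint (chainComponent ε x)) s x) : chainLength ε x ≤ s :=
  csInf_le ⟨0, fun _ hs => HasChain.nonneg hs⟩ h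

theorem exists_hasChain_lt {ε M : ℝ} {x : X} (h : chainLength ε x < M) :
    ∃ s < M, HasChain ε (basePoint (chainComponent ε x)) s x := by
  obtain ⟨s, hs, hsM⟩ := exists_lt_of_csInf_lt
    (exists_hasChain (chainComponent_basePoint (chainComponent ε x))) h
  exact ⟨s, hsM, hs⟩

/-- A nearly optimal chain to `x` extends by one step to `y`, from the same base point. -/
theorem chainLength_le_add_dist {ε : ℝ} {x y : X} (h : dist x y < ε) :
    chainLength ε y ≤ chainLength ε x + dist x y := by
  refine le_of_forall_pos_le_add fun η hη => ?_
  obtain ⟨s, hs, hc⟩ := exists_hasChain_lt (lt_add_of_pos_right (chainLength ε x) hη)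
  have hc' := hc.step h
  rw [chainComponent_eq_of_dist_lt h] at hc'
  linarith [chainLength_le hc']

theorem abs_chainLength_sub_le {ε : ℝ} {x y : X} (h : dist x y < ε) :
    |chainLength ε x - chainLength ε y| ≤ dist x y := by
  have h1 := chainLength_le_add_dist h
  have h2 := chainLength_le_add_dist (dist_comm x y ▸ h)
  rw [dist_comm y x] at h2
  exact abs_sub_le_iff.2 ⟨by linarith, by linarith⟩

theorem uniformContinuous_of_locally_abs_sub_le {f : X → ℝ} {ε : ℝ} (hε : 0 < ε)
    (h : ∀ x y, dist x y < ε → |f x - f y| ≤ dist x y) : UniformContinuous f := by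
  refine Metric.uniformContinuous_iff.2 fun η hη => ⟨min ε η, lt_min hε hη, fun x y hxy => ?_⟩
  rw [Real.dist_eq]
  exact (h x y (hxy.trans_le (min_le_left _ _))).trans_lt (hxy.trans_le (min_le_right _ _))

end Chains

/-! ### Chain length against iterated stars; uniform partitions -/

section Stars

variable {X : Type u} [PseudoMetricSpace X]

theorem mem_iterStar_succ {𝒰 : Set (Set X)} {ε : ℝ}
    (h𝒰 : ∀ x : X, ∃ U ∈ 𝒰, Metric.ball x ε ⊆ U) {A : Set X} {m : ℕ} {x y : X}
    (hx : x ∈ iterStar 𝒰 m A) (hxy : dist x y < ε) : y ∈ iterStar 𝒰 (m + 1) A := by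
  obtain ⟨U, hU, hUx⟩ := h𝒰 x
  have hε : 0 < ε := dist_nonneg.trans_lt hxy
  exact ⟨U, ⟨hU, x, hUx (Metric.mem_ball_self hε), hx⟩, hUx (by rwa [Metric.mem_ball'])⟩

theorem iterStar_mono {𝒰 : Set (Set X)} {ε : ℝ} (hε : 0 < ε)
    (h𝒰 : ∀ x : X, ∃ U ∈ 𝒰, Metric.ball x ε ⊆ U) (A : Set X) :
    Monotone fun m => iterStar 𝒰 m A :=
  monotone_nat_of_le_succ fun _ x hx => mem_iterStar_succ h𝒰 hx (by rwa [dist_self])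

/-- Chain steps may be arbitrarily short, so their number is not controlled by the length. Merging
them greedily makes each star cost `ε / 2` of length on average. -/
theorem HasChain.exists_mem_iterStar {𝒰 : Set (Set X)} {ε : ℝ} (hε : 0 < ε)
    (h𝒰 : ∀ x : X, ∃ U ∈ 𝒰, Metric.ball x ε ⊆ U) {A : Set X} {b x : X} (hb : b ∈ A) {s : ℝ}
    (h : HasChain ε b s x) :
    ∃ (k : ℕ) (y : X), y ∈ iterStar 𝒰 k A ∧ dist y x < ε ∧ k * (ε / 2) + dist y x ≤ s := by
  induction h with
  | base => exact ⟨0, b, hb, by rwa [dist_self], by simp⟩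
  | @step s x z _ hxz ih =>
    obtain ⟨k, y, hy, hyx, hs⟩ := ih
    -- While the merged step stays below `ε`, the anchor `y` is kept. Otherwise the anchor moves to
    -- `z` through two stars, paid for by the length `dist y x + dist x z ≥ ε`.
    by_cases hlt : dist y x + dist x z < ε
    · have := dist_triangle y x z
      exact ⟨k, y, hy, by linarith, by linarith⟩
    · refine ⟨k + 2, z, mem_iterStar_succ h𝒰 (mem_iterStar_succ h𝒰 hy hyx) hxz,
        by rwa [dist_self], ?_⟩
      rw [dist_self]
      push_cast
      linarith

theorem mem_iterStar_of_chainLength_lt {𝒰 : Set (Set X)} {ε : ℝ} (hε : 0 < ε)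
    (h𝒰 : ∀ x : X, ∃ U ∈ 𝒰, Metric.ball x ε ⊆ U) {A : Set X} {x : X} {M : ℝ}
    (hb : basePoint (chainComponent ε x) ∈ A) (h : chainLength ε x < M) :
    x ∈ iterStar 𝒰 (⌈2 * M / ε⌉₊ + 1) A := by
  obtain ⟨s, hs, hc⟩ := exists_hasChain_lt h
  obtain ⟨k, y, hy, hyx, hk⟩ := hc.exists_mem_iterStar hε h𝒰 hb
  -- The additional star goes from the last anchor `y` to `x`.
  refine iterStar_mono hε h𝒰 A (Nat.succ_le_succ ?_) (mem_iterStar_succ h𝒰 hy hyx)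
  have : (k : ℝ) ≤ 2 * M / ε := by
    rw [le_div_iff₀ hε]
    linarith [dist_nonneg (x := y) (y := x)]
  exact_mod_cast this.trans (Nat.le_ceil _)

theorem IsUniformCover.exists_ball_subset {𝒰 : Set (Set X)} (h : IsUniformCover 𝒰) :
    ∃ n : ℕ, ∀ x : X, ∃ U ∈ 𝒰, Metric.ball x (1 / ((n : ℝ) + 1)) ⊆ U := by
  obtain ⟨V, hV, hU⟩ := h
  obtain ⟨ε, hε, hεV⟩ := Metric.mem_uniformity_dist.1 hV
  obtain ⟨n, hn⟩ := exists_nat_one_div_lt hε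
  refine ⟨n, fun x => ?_⟩
  obtain ⟨U, hU, hxU⟩ := hU x
  refine ⟨U, hU, fun y hy => hxU (hεV ?_)⟩
  rw [Metric.mem_ball'] at hy
  exact hy.trans hn

theorem isBourbakiCauchy_of_eventually {F : Filter X}
    (h : ∀ n : ℕ, ∃ (c : ChainComponent X (1 / ((n : ℝ) + 1))) (M : ℝ), ∀ᶠ x in F,
      chainComponent (1 / ((n : ℝ) + 1)) x = c ∧ chainLength (1 / ((n : ℝ) + 1)) x < M) :
    IsBourbakiCauchy F := by
  intro 𝒰 h𝒰
  obtain ⟨n, hn⟩ := h𝒰.exists_ball_subset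
  obtain ⟨c, M, hF⟩ := h n
  obtain ⟨U, hU, hcU⟩ := hn (basePoint c)
  have hε : (0 : ℝ) < 1 / ((n : ℝ) + 1) := by positivity
  refine ⟨_, U, hU, _, hF, fun x hx => mem_iterStar_of_chainLength_lt hε hn ?_ hx.2⟩
  rw [hx.1]
  exact hcU (Metric.mem_ball_self hε)

/-- A block contains the `1 / (n + 1)`-ball around each of its points, so it is closed under chains;
distinct blocks therefore meet distinct components. -/
theorem mk_le_chainComponent {X : Type u} [PseudoMetricSpace X] {P : Set (Set X)}
    (hP : IsUniformPartition P) :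
    ∃ n : ℕ, Cardinal.mk P ≤ Cardinal.mk (ChainComponent X (1 / ((n : ℝ) + 1))) := by
  obtain ⟨n, hn⟩ := hP.2.exists_ball_subset
  have hε : (0 : ℝ) < 1 / ((n : ℝ) + 1) := by positivity
  have hne (B : P) : (B : Set X).Nonempty := Setoid.nonempty_of_mem_partition hP.1 B.2
  refine ⟨n, Cardinal.mk_le_of_injective
    (f := fun B : P => chainComponent _ (hne B).some) fun B B' hBB' => ?_⟩
  have key : ∀ y, Relation.ReflTransGen (fun x y => dist x y < 1 / ((n : ℝ) + 1))
      (hne B).some y → y ∈ (B : Set X) := fun y hy => by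
    induction hy with
    | refl => exact (hne B).some_mem
    | @tail x y _ hxy ih =>
      obtain ⟨U, hU, hxU⟩ := hn x
      have : U = B := (hP.1.2 x).unique ⟨hU, hxU (Metric.mem_ball_self hε)⟩ ⟨B.2, ih⟩
      exact this ▸ hxU (by rwa [Metric.mem_ball'])
  exact Subtype.ext ((hP.1.2 _).unique
    ⟨B.2, key _ (chainComponent_eq_iff.1 hBB')⟩ ⟨B'.2, (hne B').some_mem⟩)

theorem wp_le_iSup_prod (X : Type u) [PseudoMetricSpace X] :
    wp X ≤ ⨆ n : ℕ, ∏ j ∈ Finset.range (n + 1),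
      Cardinal.mk (ChainComponent X (1 / ((j : ℝ) + 1))) := by
  refine ciSup_le' fun P => ?_
  -- For nonempty `X` every factor is at least one, so the last factor is at most the product.
  rcases isEmpty_or_nonempty X with hX | hX
  · have : IsEmpty P.1 := ⟨fun B =>
      hX.elim (Setoid.nonempty_of_mem_partition P.2.1 B.2).some⟩
    rw [Cardinal.mk_eq_zero]
    exact zero_le
  obtain ⟨n, hn⟩ := mk_le_chainComponent P.2
  refine hn.trans (le_trans ?_ (le_ciSup Cardinal.bddAbove_of_small n))
  rw [Finset.prod_range_succ]
  refine le_mul_of_one_le_left zero_le (Finset.one_le_prod' fun j _ => ?_)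
  exact Cardinal.one_le_iff_ne_zero.2
    (Cardinal.mk_ne_zero_iff.2 (hX.map (chainComponent _)))

end Stars

/-! ### Finite covers of bounded parts, and separation of points -/

section Nets

variable {X : Type u} [PseudoMetricSpace X]

/-- The points of the `n`-th chain component `c` whose chain length at each scale `i < n` is at
most `M i`. -/
def boundedPart (n : ℕ) (M : Fin n → ℕ) (c : ChainComponent X (1 / ((n : ℝ) + 1))) : Set X :=
  {y | chainComponent (1 / ((n : ℝ) + 1)) y = c ∧
    ∀ i : Fin n, chainLength (1 / ((i : ℕ) + 1 : ℝ)) y ≤ M i}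

theorem chainComponent_eq_of_le {ε δ : ℝ} (h : ε ≤ δ) {x y : X}
    (hxy : chainComponent ε x = chainComponent ε y) :
    chainComponent δ x = chainComponent δ y :=
  chainComponent_eq_iff.2 <|
    Relation.ReflTransGen.mono (fun _ _ h' => lt_of_lt_of_le h' h) _ _ (chainComponent_eq_iff.1 hxy)

theorem boundedPart_antitone (g : ℕ → ℕ) (x : X) :
    Antitone fun n => boundedPart n (fun i => g i) (chainComponent _ x) := by
  intro m n hmn y hy
  refine ⟨chainComponent_eq_of_le (one_div_le_one_div_of_le (by positivity) ?_) hy.1,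
    fun i => hy.2 (Fin.castLE hmn i)⟩
  gcongr

/-- Otherwise the bounded parts minus finite unions of `δ`-balls generate a proper filter. It is
Bourbaki-Cauchy, yet no `p` is a cluster point, since the ball around `p` has been removed. -/
theorem exists_finite_cover_boundedPart (hX : IsBourbakiComplete X) (g : ℕ → ℕ) (x : X)
    {δ : ℝ} (hδ : 0 < δ) :
    ∃ (n : ℕ) (t : Finset X),
      boundedPart n (fun i => g i) (chainComponent _ x) ⊆ ⋃ p ∈ t, Metric.ball p δ := by
  by_contra! hcon
  let A (n : ℕ) : Set X := boundedPart n (fun i => g i) (chainComponent _ x)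
  let B (i : ℕ × Finset X) : Set X := A i.1 \ ⋃ p ∈ i.2, Metric.ball p δ
  have hB : Antitone B := fun i j hij =>
    Set.sdiff_subset_sdiff (boundedPart_antitone g x hij.1) (Set.biUnion_subset_biUnion_left hij.2)
  have hdir : Directed (· ≥ ·) fun i => 𝓟 (B i) := by
    classical
    exact (Filter.monotone_principal.comp_antitone hB).directed_ge
  let F : Filter X := ⨅ i, 𝓟 (B i)
  have hBF (i) : B i ∈ F := mem_iInf_of_mem i (mem_principal_self _)
  have hF : F.NeBot := by
    have : Nonempty X := ⟨x⟩
    exact iInf_neBot_of_directed hdir fun i =>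
      principal_neBot_iff.2 (Set.sdiff_nonempty.2 (hcon i.1 i.2))
  obtain ⟨p, hp⟩ := hX F hF <| isBourbakiCauchy_of_eventually fun n => by
    refine ⟨chainComponent _ x, g n + 1, ?_⟩
    -- Index `n + 1` is needed because `boundedPart n` bounds lengths only at scales below `n`.
    filter_upwards [hBF (n + 1, ∅)] with y hy
    refine ⟨(boundedPart_antitone g x (Nat.le_succ n) hy.1).1, ?_⟩
    exact (hy.1.2 (Fin.last n)).trans_lt (lt_add_one _)
  obtain ⟨y, hy, hyB⟩ := clusterPt_iff_nonempty.1 hp (Metric.ball_mem_nhds p hδ) (hBF (0, {p}))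
  exact hyB.2 (by simpa using hy)

/-- The sequence is chosen before the cover `t`, so it depends only on `n`, `M`, `j` and `c`, and
all points of one component share it. -/
theorem exists_net (n : ℕ) (M : Fin n → ℕ) (j : ℕ) (c : ChainComponent X (1 / ((n : ℝ) + 1))) :
    ∃ u : ℕ → X, ∀ t : Finset X,
      boundedPart n M c ⊆ ⋃ p ∈ t, Metric.ball p (1 / ((j : ℝ) + 1)) →
      boundedPart n M c ⊆ ⋃ i, Metric.ball (u i) (1 / ((j : ℝ) + 1)) := by
  by_cases h : ∃ t : Finset X, t.Nonempty ∧
      boundedPart n M c ⊆ ⋃ p ∈ t, Metric.ball p (1 / ((j : ℝ) + 1))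
  · obtain ⟨t, ht, htc⟩ := h
    obtain ⟨u, hu⟩ := t.countable_toSet.exists_eq_range ht
    refine ⟨u, fun _ _ y hy => ?_⟩
    obtain ⟨p, hp, hyp⟩ := Set.mem_iUnion₂.1 (htc hy)
    obtain ⟨i, rfl⟩ : p ∈ Set.range u := hu ▸ hp
    exact Set.mem_iUnion.2 ⟨i, hyp⟩
  -- The constant sequence is a dummy: here only an empty bounded part can have a finite cover.
  · refine ⟨fun _ => basePoint c, fun t ht y hy => ?_⟩
    obtain ⟨p, hp, -⟩ := Set.mem_iUnion₂.1 (ht hy)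
    exact (h ⟨t, ⟨p, hp⟩, ht⟩).elim

/-- Points whose balls of radius `1 / (j + 1)` cover `boundedPart n M c` if this set has a finite
cover by such balls. -/
noncomputable def net (n : ℕ) (M : Fin n → ℕ) (j : ℕ)
    (c : ChainComponent X (1 / ((n : ℝ) + 1))) : ℕ → X :=
  (exists_net n M j c).choose

/-- The index set of the real coordinates: chain lengths, and distances to points of nets. -/
abbrev CoordIndex : Type := ℕ ⊕ ((Σ n : ℕ, Fin n → ℕ) × ℕ × ℕ)

/-- The real coordinates of a point. -/
noncomputable def realCoord : CoordIndex → X → ℝ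
  | .inl n, x => chainLength (1 / ((n : ℝ) + 1)) x
  | .inr (⟨n, M⟩, j, i), x => dist x (net n M j (chainComponent _ x) i)

theorem uniformContinuous_realCoord (k : CoordIndex) :
    UniformContinuous (realCoord (X := X) k) := by
  rcases k with n | ⟨⟨n, M⟩, j, i⟩
  · exact uniformContinuous_of_locally_abs_sub_le (Nat.one_div_pos_of_nat (n := n))
      fun x y h => abs_chainLength_sub_le h
  · refine uniformContinuous_of_locally_abs_sub_le (Nat.one_div_pos_of_nat (n := n))
      fun x y h => ?_
    simp only [realCoord, chainComponent_eq_of_dist_lt h]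
    exact abs_dist_sub_le _ _ _

/-- Some net point is closer to `x` than half of `dist x y`; equal coordinates put it equally close
to `y`, against the triangle inequality. -/
theorem eq_of_coords {X : Type u} [MetricSpace X] (hX : IsBourbakiComplete X) {x y : X}
    (hc : ∀ n : ℕ, chainComponent (1 / ((n : ℝ) + 1)) x = chainComponent (1 / ((n : ℝ) + 1)) y)
    (hr : ∀ k, realCoord k x = realCoord k y) : x = y := by
  by_contra hxy
  obtain ⟨j, hj⟩ := exists_nat_one_div_lt (half_pos (dist_pos.2 hxy))
  let g (n : ℕ) : ℕ := ⌈chainLength (1 / ((n : ℝ) + 1)) x⌉₊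
  obtain ⟨n, t, ht⟩ := exists_finite_cover_boundedPart hX g x (Nat.one_div_pos_of_nat (n := j))
  have hx := (exists_net n (fun i => g i) j _).choose_spec t ht ⟨rfl, fun i => Nat.le_ceil _⟩
  obtain ⟨i, hi⟩ := Set.mem_iUnion.1 hx
  have h := hr (.inr (⟨n, fun i => g i⟩, j, i))
  simp only [realCoord, ← hc n] at h
  replace hi : dist x (net n (fun i => g i) j (chainComponent _ x) i) < 1 / ((j : ℝ) + 1) := hi
  have := dist_triangle_right x y (net n (fun i => g i) j (chainComponent _ x) i)
  rw [← h] at this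
  linarith

end Nets

/-! ### Convergence and uniform continuity in the target metric -/

section Target

theorem rho_lt_of_forall_le {E : ℕ → Type u} {x y : ∀ n, E n} {N : ℕ}
    (h : ∀ n ≤ N, x n = y n) : rho x y < 1 / ((N : ℝ) + 1) := by
  unfold rho
  split_ifs with hxy
  · positivity
  · have : N < PiNat.firstDiff x y := by
      by_contra! hle
      exact PiNat.apply_firstDiff_ne hxy (h _ hle)
    refine one_div_lt_one_div_of_lt (by positivity) ?_
    gcongr

theorem eq_of_rho_lt {E : ℕ → Type u} {x y : ∀ n, E n} {n : ℕ}
    (h : rho x y < 1 / ((n : ℝ) + 1)) : x n = y n := by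
  by_contra hne
  have hxy : x ≠ y := fun h => hne (congrFun h n)
  rw [rho, if_neg hxy] at h
  have hlt := lt_of_one_div_lt_one_div (by positivity) h
  have : n < PiNat.firstDiff x y := by exact_mod_cast (add_lt_add_iff_right (1 : ℝ)).1 hlt
  exact hne (PiNat.apply_eq_of_lt_firstDiff this)

theorem tendsto_tDist {α : Type*} {l : Filter α} {f g : α → ℕ → ℝ}
    (h : ∀ n, Tendsto (fun a => f a n - g a n) l (𝓝 0)) :
    Tendsto (fun a => tDist (f a) (g a)) l (𝓝 0) := by
  have hs : Summable fun n : ℕ => (1 / 2 : ℝ) ^ (n + 1) :=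
    (summable_nat_add_iff 1).2 summable_geometric_two
  have := tendsto_tsum_of_dominated_convergence (𝓕 := l)
    (f := fun a n => min |f a n - g a n| 1 / (2 : ℝ) ^ (n + 1)) (g := fun _ => (0 : ℝ)) hs
    (fun n => by
      simpa using ((h n).abs.min (tendsto_const_nhds (x := (1 : ℝ)))).div_const ((2 : ℝ) ^ (n + 1)))
    (.of_forall fun a n => by
      rw [Real.norm_of_nonneg (tDist_term_nonneg _ _ n), div_pow, one_pow]
      gcongr
      exact min_le_right _ _)
  simpa [tDist] using this

theorem abs_sub_lt_one_of_tDist_lt {x y : ℕ → ℝ} {n : ℕ}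
    (h : tDist x y < 1 / (2 : ℝ) ^ (n + 1)) : |x n - y n| < 1 := by
  have h1 := ((tDist_summable x y).le_tsum n fun m _ => tDist_term_nonneg x y m).trans_lt h
  have h2 := (div_lt_div_iff_of_pos_right (by positivity)).1 h1
  exact (min_lt_iff.1 h2).resolve_right (lt_irrefl _)

variable {κ : ℕ → Cardinal.{u}}

theorem UniversalSpace.dist_def (a b : UniversalSpace κ) :
    dist a b = rho a.1 b.1 + tDist a.2 b.2 := rfl

theorem UniversalSpace.eventually_fst_eq (a : UniversalSpace κ) (n : ℕ) :
    ∀ᶠ b in 𝓝 a, b.1 n = a.1 n := by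
  filter_upwards [Metric.ball_mem_nhds a (Nat.one_div_pos_of_nat (α := ℝ) (n := n))] with b hb
  rw [Metric.mem_ball, UniversalSpace.dist_def] at hb
  exact eq_of_rho_lt (by linarith [tDist_nonneg b.2 a.2])

theorem UniversalSpace.eventually_snd_lt (a : UniversalSpace κ) (n : ℕ) :
    ∀ᶠ b in 𝓝 a, b.2 n < a.2 n + 1 := by
  have hpos : (0 : ℝ) < 1 / 2 ^ (n + 1) := by positivity
  filter_upwards [Metric.ball_mem_nhds a hpos] with b hb
  rw [Metric.mem_ball, UniversalSpace.dist_def] at hb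
  have := abs_sub_lt_one_of_tDist_lt (x := b.2) (y := a.2) (n := n)
    (by linarith [rho_nonneg b.1 a.1])
  linarith [(abs_lt.1 this).2]

theorem UniversalSpace.uniformContinuous_of_coords {X : Type*} [UniformSpace X]
    {φ : X → UniversalSpace κ}
    (h1 : ∀ n, ∀ᶠ p : X × X in uniformity X, (φ p.1).1 n = (φ p.2).1 n)
    (h2 : ∀ n, UniformContinuous fun x => (φ x).2 n) : UniformContinuous φ := by
  have ht : Tendsto (fun p : X × X => tDist (φ p.1).2 (φ p.2).2) (uniformity X) (𝓝 0) :=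
    tendsto_tDist fun n => by
      have := tendsto_uniformity_iff_dist_tendsto_zero.1 (h2 n)
      simp only [Real.dist_eq] at this
      exact (tendsto_zero_iff_abs_tendsto_zero _).2 this
  have hr : Tendsto (fun p : X × X => rho (φ p.1).1 (φ p.2).1) (uniformity X) (𝓝 0) := by
    refine Metric.tendsto_nhds.2 fun ε hε => ?_
    obtain ⟨N, hN⟩ := exists_nat_one_div_lt hε
    filter_upwards [(Set.finite_Iic N).eventually_all.2 fun n _ => h1 n] with p hp
    rw [Real.dist_0_eq_abs, abs_of_nonneg (rho_nonneg _ _)]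
    exact (rho_lt_of_forall_le hp).trans hN
  refine tendsto_uniformity_iff_dist_tendsto_zero.2 ?_
  simpa only [UniversalSpace.dist_def, add_zero] using hr.add ht

end Target

/-! ### The closed embedding -/

section Embedding

variable {X : Type u} [PseudoMetricSpace X]

/-- The number of chain components for steps shorter than `1 / (n + 1)`. -/
noncomputable def chainCard (X : Type u) [PseudoMetricSpace X] (n : ℕ) : Cardinal.{u} :=
  Cardinal.mk (ChainComponent X (1 / ((n : ℝ) + 1)))

/-- An enumeration of the chain components by the ordinals below their cardinal number. -/
noncomputable def chainComponentEquiv (X : Type u) [PseudoMetricSpace X] (n : ℕ) :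
    ChainComponent X (1 / ((n : ℝ) + 1)) ≃ (chainCard X n).ord.ToType :=
  (Cardinal.eq.1 (Cardinal.mk_ord_toType (chainCard X n)).symm).some

/-- An enumeration of the indices of the real coordinates. -/
noncomputable def coordEnum : ℕ → CoordIndex := (exists_surjective_nat CoordIndex).choose

theorem coordEnum_surjective : Function.Surjective coordEnum :=
  (exists_surjective_nat CoordIndex).choose_spec

/-- The map into the universal space given by the chain components at all scales and the real
coordinates. -/
noncomputable def universalMap (x : X) : UniversalSpace (chainCard X) :=
  (fun n => chainComponentEquiv X n (chainComponent _ x), fun k => realCoord (coordEnum k) x)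

theorem uniformContinuous_universalMap : UniformContinuous (universalMap (X := X)) := by
  refine UniversalSpace.uniformContinuous_of_coords (fun n => ?_)
    fun k => uniformContinuous_realCoord (coordEnum k)
  filter_upwards [Metric.dist_mem_uniformity (Nat.one_div_pos_of_nat (n := n))] with p hp
  exact congrArg _ (chainComponent_eq_of_dist_lt hp)

theorem universalMap_injective {X : Type u} [MetricSpace X] (hX : IsBourbakiComplete X) :
    Function.Injective (universalMap (X := X)) := by
  intro x y h
  refine eq_of_coords hX (fun n => (chainComponentEquiv X n).injective ?_) fun k => ?_
  · exact congrFun (congrArg Prod.fst h) n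
  · obtain ⟨m, rfl⟩ := coordEnum_surjective k
    exact congrFun (congrArg Prod.snd h) m

theorem isBourbakiCauchy_of_tendsto_universalMap {F : Filter X}
    {a : UniversalSpace (chainCard X)} (h : Tendsto universalMap F (𝓝 a)) :
    IsBourbakiCauchy F := by
  refine isBourbakiCauchy_of_eventually fun n => ?_
  obtain ⟨k, hk⟩ := coordEnum_surjective (.inl n)
  refine ⟨(chainComponentEquiv X n).symm (a.1 n), a.2 k + 1, ?_⟩
  filter_upwards [h.eventually (a.eventually_fst_eq n), h.eventually (a.eventually_snd_lt k)]
    with x h1 h2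
  refine ⟨(chainComponentEquiv X n).eq_symm_apply.2 h1, ?_⟩
  simpa only [universalMap, hk, realCoord] using h2

/-- For a cluster point `a` of the image of `s`, pulling back the neighbourhoods of `a` and
restricting to `s` gives a proper Bourbaki-Cauchy filter. By continuity and uniqueness of limits,
its cluster point is sent to `a`. -/
theorem isClosedMap_universalMap (hX : IsBourbakiComplete X) :
    IsClosedMap (universalMap (X := X)) := by
  refine isClosedMap_iff_clusterPt.2 fun s a ha => ?_
  have hG : (comap universalMap (𝓝 a) ⊓ 𝓟 s).NeBot := by
    have : (𝓝 a ⊓ map universalMap (𝓟 s)).NeBot := ha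
    rw [← Filter.push_pull', map_neBot_iff] at this
    exact this
  have hlim : Tendsto universalMap (comap universalMap (𝓝 a) ⊓ 𝓟 s) (𝓝 a) :=
    tendsto_comap.mono_left inf_le_left
  obtain ⟨x, hx⟩ := hX _ hG (isBourbakiCauchy_of_tendsto_universalMap hlim)
  refine ⟨x, ?_, hx.mono inf_le_right⟩
  have : (𝓝 x ⊓ (comap universalMap (𝓝 a) ⊓ 𝓟 s)).NeBot := hx
  exact tendsto_nhds_unique
    ((uniformContinuous_universalMap.continuous.tendsto x).mono_left inf_le_left)
    (hlim.mono_left inf_le_right)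

end Embedding

end BourbakiEmbedding

theorem mainTheorem5 (X : Type u) [MetricSpace X]
    (hX : BourbakiEmbedding.IsBourbakiComplete X) :
    ∃ (κ : ℕ → Cardinal.{u}) (φ : X → BourbakiEmbedding.UniversalSpace κ),
      Topology.IsEmbedding φ ∧ UniformContinuous φ ∧ IsClosed (Set.range φ) ∧
      BourbakiEmbedding.wp X ≤ ⨆ n : ℕ, ∏ j ∈ Finset.range (n + 1), κ j := by
  have huc := BourbakiEmbedding.uniformContinuous_universalMap (X := X)
  have hemb := Topology.IsClosedEmbedding.of_continuous_injective_isClosedMap huc.continuous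
    (BourbakiEmbedding.universalMap_injective hX) (BourbakiEmbedding.isClosedMap_universalMap hX)
  exact ⟨BourbakiEmbedding.chainCard X, BourbakiEmbedding.universalMap, hemb.isEmbedding, huc,
    hemb.isClosed_range, BourbakiEmbedding.wp_le_iSup_prod X⟩
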